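/- An Artin algebra is a ring $A$ that is an algebra over some commutative Artinian ring $R$ and is finitely generated as an $R$-module; $A$-mod denotes the category of finitely generated left $A$-modules. Two Artin algebras $A$ and $B$ are derived equivalent if the bounded derived categories $D^b(A\text{-mod})$ and $D^b(B\text{-mod})$ are equivalent as triangulated categories. An Artin algebra $A$ is said to satisfy the generalized Auslander–Reiten conjecture if, for every finitely generated left $A$-module $X$ and every integer $r \ge 0$, the condition $\operatorname{Ext}^i_A(X,X)=0=\operatorname{Ext}^i_A(X,A)$ for all $i>r$ implies that the projective dimension of $X$ is at most $r$. Theorem. Let $A$ and $B$ be Artin algebras that are derived equivalent. Then $A$ satisfies the generalized Auslander–Reiten conjecture if and only if $B$ does. -/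

import Mathlib

open CategoryTheory

universe u v

/-- `A` is an Artin algebra: it is an algebra over some commutative Artinian ring `R` and is
finitely generated as an `R`-module. Taking `R` in the universe of `A` is no restriction
(see `IsArtinAlgebra.of_algebra`): one may replace `R` by its image in `A`. -/
class IsArtinAlgebra (A : Type u) [Ring A] : Prop where
  exists_base : ∃ (R : Type u) (_ : CommRing R) (_ : Algebra R A),
    IsArtinianRing R ∧ Module.Finite R A

/-- An algebra, finitely generated as a module, over a commutative Artinian ring in any
universe is an Artin algebra. -/
theorem IsArtinAlgebra.of_algebra (R : Type v) (A : Type u) [CommRing R] [IsArtinianRing R]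
    [Ring A] [Algebra R A] [Module.Finite R A] : IsArtinAlgebra A := by
  let I : Ideal R := RingHom.ker (algebraMap R A)
  let f : R ⧸ I →+* A := RingHom.kerLift (algebraMap R A)
  have hf : Function.Injective f := RingHom.kerLift_injective _
  have : Small.{u} (R ⧸ I) := small_of_injective hf
  let e : Shrink.{u} (R ⧸ I) ≃+* (R ⧸ I) := Shrink.ringEquiv (R ⧸ I)
  let g : R →+* Shrink.{u} (R ⧸ I) := (e.symm : (R ⧸ I) →+* _).comp (Ideal.Quotient.mk I)
  have hg : Function.Surjective g :=
    e.symm.surjective.comp Ideal.Quotient.mk_surjective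
  let a : Shrink.{u} (R ⧸ I) →+* A := f.comp (e : _ →+* R ⧸ I)
  have hag : ∀ r, a (g r) = algebraMap R A r := by
    intro r
    simp [a, g, f, I]
  let : Algebra (Shrink.{u} (R ⧸ I)) A := a.toAlgebra' (by
    intro c x
    obtain ⟨r, rfl⟩ := hg c
    rw [hag]
    exact Algebra.commutes r x)
  have : IsScalarTower R (Shrink.{u} (R ⧸ I)) A :=
    IsScalarTower.of_algebraMap_eq (fun r => (hag r).symm)
  exact ⟨_, inferInstance, inferInstance, hg.isArtinianRing,
    Module.Finite.of_restrictScalars_finite R _ A⟩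

instance IsArtinAlgebra.isNoetherianRing (A : Type u) [Ring A] [h : IsArtinAlgebra A] :
    IsNoetherianRing A := by
  obtain ⟨R, _, _, _, _⟩ := h.exists_base
  have : IsNoetherian R A := isNoetherian_of_isNoetherianRing_of_finite R A
  exact isNoetherian_of_tower R inferInstance

/-- The Artin algebras `A` and `B` are derived equivalent: there is an equivalence of
triangulated categories between `D^b(A-mod)` and `D^b(B-mod)`, that is, an equivalence of
categories which commutes with the shifts and sends distinguished triangles to distinguished
triangles. Here `A-mod` is the abelian category of finitely generated left `A`-modules. -/
def DerivedEquivalent (A : Type u) (B : Type v) [Ring A] [Ring B]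
    [IsArtinAlgebra A] [IsArtinAlgebra B] : Prop :=
  letI := HasDerivedCategory.standard (FGModuleCat.{u} A)
  letI := HasDerivedCategory.standard (FGModuleCat.{v} B)
  ∃ (F : DerivedCategory.Bounded (FGModuleCat.{u} A) ⥤
      DerivedCategory.Bounded (FGModuleCat.{v} B)) (_ : F.CommShift ℤ),
    F.IsEquivalence ∧ F.IsTriangulated

/-- The generalized Auslander-Reiten conjecture for `A`. -/
def GeneralizedAuslanderReiten (A : Type u) [Ring A] : Prop :=
  ∀ (X : Type u) [AddCommGroup X] [Module A X] [Module.Finite A X] (r : ℕ),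
    (∀ i : ℕ, r < i →
      Subsingleton (Abelian.Ext (ModuleCat.of A X) (ModuleCat.of A X) i) ∧
      Subsingleton (Abelian.Ext (ModuleCat.of A X) (ModuleCat.of A A) i)) →
    projectiveDimension (ModuleCat.of A X) ≤ (r : WithBot ℕ∞)

universe w w'

open Limits Pretriangulated ZeroObject Abelian DerivedCategory DerivedCategory.TStructure

/-! The conjecture is recast in terms visible to the category `D^b` and its shift alone. Write `X ⊥
Y` if `Hom(X, Y[i]) = 0` for `i ≫ 0`. Call `X` perfect if `X ⊥ Y` for all `Y`. The condition "`X ⊥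
X` and `X ⊥ P` for all perfect `P` imply that `X` is perfect" is invariant under equivalences
commuting with shifts.

It remains to match this with the statement on modules. Mapping a projective onto the top cohomology
of a bounded complex `X` gives a triangle `P[-n] ⟶ X ⟶ Z` with `Z` of smaller amplitude. As `P` is
perfect, `X` and `Z` have the same morphisms to high shifts of any bounded object, so the question
descends to modules (`bounded_induction`). There, eventual vanishing of `Ext` against `A ⧸ rad A`
bounds the projective dimension, and vanishing of `Ext` into projectives above `r` sharpens the
bound to `r`. -/

namespace CategoryTheory

/-! ### Conditions intrinsic to a category with shift -/

section Shift

variable {T : Type*} [Category* T] [HasZeroMorphisms T] [HasShift T ℤ]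

/-- All morphisms from `X` to sufficiently high shifts of `Y` vanish. -/
def EventuallyOrthogonal (X Y : T) : Prop :=
  ∃ n : ℤ, ∀ i : ℤ, n < i → ∀ f : X ⟶ Y⟦i⟧, f = 0

lemma EventuallyOrthogonal.of_iso_left {X X' Y : T} (h : EventuallyOrthogonal X Y)
    (e : X ≅ X') : EventuallyOrthogonal X' Y := by
  obtain ⟨n, hn⟩ := h
  exact ⟨n, fun i hi f ↦ by rw [← cancel_epi e.hom, hn i hi (e.hom ≫ f), comp_zero]⟩

lemma EventuallyOrthogonal.of_iso_right {X Y Y' : T} (h : EventuallyOrthogonal X Y)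
    (e : Y ≅ Y') : EventuallyOrthogonal X Y' := by
  obtain ⟨n, hn⟩ := h
  exact ⟨n, fun i hi f ↦ by rw [← cancel_mono (e.inv⟦i⟧'), hn i hi (f ≫ e.inv⟦i⟧'), zero_comp]⟩

lemma EventuallyOrthogonal.shift_right {X Y : T} (h : EventuallyOrthogonal X Y) (a : ℤ) :
    EventuallyOrthogonal X (Y⟦a⟧) := by
  obtain ⟨n, hn⟩ := h
  refine ⟨n - a, fun i hi f ↦ ?_⟩
  rw [← cancel_mono ((shiftFunctorAdd T a i).inv.app Y), zero_comp]
  exact hn (a + i) (by lia) _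

variable {T' : Type*} [Category* T'] [HasZeroMorphisms T'] [HasShift T' ℤ]

lemma eventuallyOrthogonal_map_iff (F : T ⥤ T') [F.CommShift ℤ] [F.Full] [F.Faithful]
    [F.PreservesZeroMorphisms] (X Y : T) :
    EventuallyOrthogonal (F.obj X) (F.obj Y) ↔ EventuallyOrthogonal X Y := by
  refine exists_congr fun n ↦ forall₂_congr fun i _ ↦ ⟨fun h f ↦ ?_, fun h f ↦ ?_⟩
  · apply F.map_injective
    rw [← cancel_mono ((F.commShiftIso i).hom.app Y), F.map_zero, zero_comp]
    exact h _
  · obtain ⟨g, hg⟩ := F.map_surjective (f ≫ (F.commShiftIso i).inv.app Y)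
    rw [← cancel_mono ((F.commShiftIso i).inv.app Y), ← hg, h g, F.map_zero, zero_comp]

/-- In a bounded derived category of an Artin algebra, this property
characterizes the perfect complexes. -/
def HomologicallyPerfect (P : T) : Prop :=
  ∀ Y : T, EventuallyOrthogonal P Y

lemma homologicallyPerfect_map_iff (F : T ⥤ T') [F.CommShift ℤ] [F.IsEquivalence]
    [F.PreservesZeroMorphisms] (X : T) :
    HomologicallyPerfect (F.obj X) ↔ HomologicallyPerfect X :=
  ⟨fun h Y ↦ (eventuallyOrthogonal_map_iff F X Y).1 (h _), fun h Y ↦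
    ((eventuallyOrthogonal_map_iff F X _).2 (h _)).of_iso_right (F.objObjPreimageIso Y)⟩

variable (T) in
/-- The generalized Auslander-Reiten condition for a category with shift. -/
def AuslanderReitenCondition : Prop :=
  ∀ X : T, EventuallyOrthogonal X X →
    (∀ P : T, HomologicallyPerfect P → EventuallyOrthogonal X P) → HomologicallyPerfect X

lemma auslanderReitenCondition_iff_of_isEquivalence (F : T ⥤ T') [F.CommShift ℤ]
    [F.IsEquivalence] [F.PreservesZeroMorphisms] :
    AuslanderReitenCondition T ↔ AuslanderReitenCondition T' := by
  constructor
  · intro h X' hX' hP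
    let e := F.objObjPreimageIso X'
    have : HomologicallyPerfect (F.obj (F.objPreimage X')) := by
      rw [homologicallyPerfect_map_iff]
      refine h _ ?_ fun P hPP ↦ ?_
      · rw [← eventuallyOrthogonal_map_iff F]
        exact (hX'.of_iso_left e.symm).of_iso_right e.symm
      · rw [← eventuallyOrthogonal_map_iff F]
        exact (hP _ ((homologicallyPerfect_map_iff F P).2 hPP)).of_iso_left e.symm
    exact fun Y ↦ (this Y).of_iso_left e
  · intro h X hX hP
    rw [← homologicallyPerfect_map_iff F]
    refine h _ ((eventuallyOrthogonal_map_iff F X X).2 hX) fun P hPP ↦ ?_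
    let e := F.objObjPreimageIso P
    refine ((eventuallyOrthogonal_map_iff F _ _).2 (hP (F.objPreimage P) ?_)).of_iso_right e
    rw [← homologicallyPerfect_map_iff F]
    exact fun Y ↦ (hPP Y).of_iso_left e.symm

end Shift

/-! ### Closure of eventual orthogonality under triangles -/

section Pretriangulated

variable {T : Type*} [Category* T] [Preadditive T] [HasShift T ℤ]
  [∀ n : ℤ, (shiftFunctor T n).Additive]

lemma EventuallyOrthogonal.shift_left {X Y : T} (h : EventuallyOrthogonal X Y) (a : ℤ) :
    EventuallyOrthogonal (X⟦a⟧) Y := by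
  obtain ⟨n, hn⟩ := h
  refine ⟨n + a, fun i hi f ↦ ?_⟩
  obtain ⟨g, hg⟩ := (shiftFunctor T a).map_surjective
    (f ≫ (shiftFunctorAdd' T (i - a) a i (by lia)).hom.app Y)
  rw [← cancel_mono ((shiftFunctorAdd' T (i - a) a i (by lia)).hom.app Y), ← hg,
    hn (i - a) (by lia) g, Functor.map_zero, zero_comp]

variable [HasZeroObject T] [Pretriangulated T]

/-- The objects to whose high shifts `X` has no nonzero morphisms. -/
def rightEventuallyOrthogonal (X : T) : ObjectProperty T :=
  fun Y ↦ EventuallyOrthogonal X Y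

/-- The objects without nonzero morphisms to high shifts of `Y`. -/
def leftEventuallyOrthogonal (Y : T) : ObjectProperty T :=
  fun X ↦ EventuallyOrthogonal X Y

instance (X : T) : (rightEventuallyOrthogonal X).IsClosedUnderIsomorphisms where
  of_iso e h := h.of_iso_right e

instance (X : T) : (leftEventuallyOrthogonal X).IsClosedUnderIsomorphisms where
  of_iso e h := h.of_iso_left e

instance (X : T) : (rightEventuallyOrthogonal X).IsTriangulated where
  exists_zero := ⟨0, isZero_zero T, 0, fun i _ _ ↦
    ((shiftFunctor T i).map_isZero (isZero_zero T)).eq_of_tgt _ _⟩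
  isStableUnderShiftBy a := ⟨fun _ h ↦ h.shift_right a⟩
  toIsTriangulatedClosed₂ := .mk' fun D hD ⟨m, hm⟩ ⟨n, hn⟩ ↦ ⟨max m n, fun i hi f ↦ by
    obtain ⟨g, hg⟩ := Triangle.coyoneda_exact₂ _ (Triangle.shift_distinguished D hD i) f
      (hn i (by lia) _)
    rw [hg, hm i (by lia) g]
    exact zero_comp⟩

instance (Y : T) : (leftEventuallyOrthogonal Y).IsTriangulated where
  exists_zero := ⟨0, isZero_zero T, 0, fun i _ _ ↦ (isZero_zero T).eq_of_src _ _⟩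
  isStableUnderShiftBy a := ⟨fun _ h ↦ h.shift_left a⟩
  toIsTriangulatedClosed₂ := .mk' fun D hD ⟨m, hm⟩ ⟨n, hn⟩ ↦ ⟨max m n, fun i hi f ↦ by
    obtain ⟨g, hg⟩ := Triangle.yoneda_exact₂ _ hD f (hm i (by lia) _)
    rw [hg, hn i (by lia) g, comp_zero]⟩

end Pretriangulated

/-! ### Induction on cohomological amplitude -/

variable {C : Type u} [Category.{v} C] [Abelian C]

lemma eventuallyOrthogonal_singleFunctor_iff [HasDerivedCategory.{w'} C] [HasExt.{w} C]
    (M N : C) :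
    EventuallyOrthogonal ((singleFunctor C 0).obj M) ((singleFunctor C 0).obj N) ↔
      ∃ n : ℕ, ∀ i : ℕ, n < i → Subsingleton (Ext M N i) := by
  constructor
  · rintro ⟨n, hn⟩
    refine ⟨n.toNat, fun i hi ↦ ⟨fun x y ↦ ?_⟩⟩
    apply Ext.homEquiv.injective
    exact (hn i (by lia) _).trans (hn i (by lia) _).symm
  · rintro ⟨n, hn⟩
    refine ⟨n, fun i hi f ↦ ?_⟩
    lift i to ℕ using by lia
    have := hn i (by lia)
    have hs : Subsingleton (ShiftedHom ((singleFunctor C 0).obj M) ((singleFunctor C 0).obj N)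
      (i : ℤ)) := (Ext.homEquiv (X := M) (Y := N)).symm.subsingleton
    exact hs.elim f 0

namespace DerivedCategory

variable [HasDerivedCategory.{w'} C]

lemma from_singleFunctor_obj_eq_zero_of_isLE {P : C} [Projective P] {i : ℤ}
    {Y : DerivedCategory C} (f : (singleFunctor C i).obj P ⟶ Y) (n : ℤ) (hn : n < i)
    [Y.IsLE n] : f = 0 := by
  obtain ⟨L, _, ⟨e⟩⟩ := exists_iso_Q_obj_of_isLE Y n
  rw [← cancel_mono e.hom, zero_comp]
  exact from_singleFunctor_obj_eq_zero_of_projective (f ≫ e.hom) n hn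

/-- Killing the top cohomology of a complex by a projective object. -/
lemma exists_triangle_of_isGE_of_isLE [EnoughProjectives C] (X : DerivedCategory C) (a b : ℤ)
    (hab : a < b) [X.IsGE a] [X.IsLE b] :
    ∃ (P : C) (_ : Projective P) (Z : DerivedCategory C) (_ : Z.IsGE a) (_ : Z.IsLE (b - 1))
      (f : (singleFunctor C b).obj P ⟶ X) (g : X ⟶ Z)
      (h : Z ⟶ ((singleFunctor C b).obj P)⟦(1 : ℤ)⟧), Triangle.mk f g h ∈ distTriang _ := by
  have hτ : Triangle.mk ((t.truncLTι b).app X) ((t.truncGEπ b).app X)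
      ((t.truncGEδLT b).app X) ∈ distTriang _ := t.triangleLTGE_distinguished b X
  obtain ⟨M, ⟨e⟩⟩ := exists_iso_singleFunctor_obj_of_isGE_of_isLE ((t.truncGE b).obj X) b
  let u : (singleFunctor C b).obj (Projective.over M) ⟶ (t.truncGE b).obj X :=
    (singleFunctor C b).map (Projective.π M) ≫ e.inv
  have : (((t.truncLT b).obj X)⟦(1 : ℤ)⟧).IsLE (b - 2) :=
    t.isLE_shift _ (b - 1) 1 (b - 2)
  -- The obstruction to lifting `u` to `X` is a map from a projective in degree `b` to an object in
  -- degrees at most `b - 2`, hence zero.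
  obtain ⟨f, hf⟩ := Triangle.coyoneda_exact₃ _ hτ u
    (from_singleFunctor_obj_eq_zero_of_isLE (Y := ((t.truncLT b).obj X)⟦(1 : ℤ)⟧) _ (b - 2)
      (by lia))
  change (singleFunctor C b).obj (Projective.over M) ⟶ X at f
  replace hf : u = f ≫ (t.truncGEπ b).app X := hf
  obtain ⟨Z, g, h, hT⟩ := distinguished_cocone_triangle f
  refine ⟨_, inferInstance, Z, ?_, ?_, f, g, h, hT⟩
  · have : (((singleFunctor C b).obj (Projective.over M))⟦(1 : ℤ)⟧).IsGE (b - 1) :=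
      t.isGE_shift _ b 1 (b - 1)
    exact t.isGE₂ _ (rot_of_distTriang _ hT) a ‹_› (t.isGE_of_ge
      (((singleFunctor C b).obj (Projective.over M))⟦(1 : ℤ)⟧) a (b - 1))
  · rw [isLE_iff]
    intro i hi
    have hu : Epi ((homologyFunctor C b).map u) := by
      have : Epi ((homologyFunctor C b).map ((singleFunctor C b).map (Projective.π M))) :=
        ((MorphismProperty.epimorphisms C).arrow_mk_iso_iff
          (((Functor.mapArrowFunctor _ _).mapIso
            (singleFunctorCompHomologyFunctorIso C b)).app (Arrow.mk (Projective.π M)))).2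
          (inferInstanceAs (Epi (Projective.π M)))
      dsimp only [u]
      rw [Functor.map_comp]
      infer_instance
    -- For `i ≥ b` the map `H^i(g)` is both zero and epi, so `H^i(Z) = 0`. At `i = b` it is zero
    -- because `H^b(f)` is epi: `H^b(u)` is epi and truncation is an isomorphism on `H^b`.
    have hg : (homologyFunctor C i).map g = 0 := by
      obtain rfl | hbi : b = i ∨ b < i := by lia
      · refine (HomologySequence.epi_homologyMap_mor₁_iff _ hT b).1 ?_
        have : Mono ((homologyFunctor C b).map ((t.truncGEπ b).app X)) := by
          refine (HomologySequence.mono_homologyMap_mor₂_iff _ hτ b).2 ?_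
          exact (isZero_of_isLE ((t.truncLT b).obj X) (b - 1) b (by lia)).eq_of_src _ _
        rw [hf, Functor.map_comp] at hu
        have := epi_of_epi ((homologyFunctor C b).map f)
          ((homologyFunctor C b).map ((t.truncGEπ b).app X))
        have := isIso_of_mono_of_epi ((homologyFunctor C b).map ((t.truncGEπ b).app X))
        exact (epi_comp_iff_of_isIso _ ((homologyFunctor C b).map ((t.truncGEπ b).app X))).1 hu
      · exact (isZero_of_isLE X b i hbi).eq_of_src _ _
    have : Epi ((homologyFunctor C i).map g) :=
      (HomologySequence.epi_homologyMap_mor₂_iff _ hT i (i + 1) rfl).2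
      ((isZero_of_isLE ((singleFunctor C b).obj (Projective.over M)) b (i + 1)
        (by lia)).eq_of_tgt _ _)
    rw [IsZero.iff_id_eq_zero, ← cancel_epi ((homologyFunctor C i).map g), hg, zero_comp,
      zero_comp]

/-- Induction on the amplitude `k` of `X` in degrees `[a, a + k]`. Only the passage from `Z` to `X`
is required, so it applies to properties, such as implications, that need not be closed under
triangles. -/
lemma bounded_induction [EnoughProjectives C] (p : ObjectProperty (DerivedCategory C))
    [p.IsClosedUnderIsomorphisms]
    (single : ∀ (n : ℤ) (M : C), p ((singleFunctor C n).obj M))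
    (triangle : ∀ (n : ℤ) (P : C) (X Z : DerivedCategory C) (_ : Projective P)
      (_ : t.bounded X) (_ : t.bounded Z)
      (f : (singleFunctor C n).obj P ⟶ X) (g : X ⟶ Z)
      (h : Z ⟶ ((singleFunctor C n).obj P)⟦(1 : ℤ)⟧) (_ : Triangle.mk f g h ∈ distTriang _),
      p Z → p X)
    (X : DerivedCategory C) (hX : t.bounded X) : p X := by
  obtain ⟨⟨a, ha⟩, b, hb⟩ := hX
  obtain ⟨k, hk⟩ : ∃ k : ℕ, b ≤ a + k := ⟨(b - a).toNat, by lia⟩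
  replace hb : X.IsLE (a + k) := t.isLE_of_le X b (a + k)
  clear hk
  induction k generalizing X with
  | zero =>
    have : X.IsLE a := by simpa using hb
    obtain ⟨M, ⟨e⟩⟩ := exists_iso_singleFunctor_obj_of_isGE_of_isLE X a
    exact p.prop_of_iso e.symm (single a M)
  | succ k hk =>
    obtain ⟨P, hP, Z, hZ, hZ', f, g, h, hT⟩ :=
      exists_triangle_of_isGE_of_isLE X a (a + (k + 1 : ℕ)) (by lia)
    replace hZ' : Z.IsLE (a + k) := by
      convert! hZ' using 1
      push_cast
      ring
    exact triangle _ P X Z hP ⟨⟨_, ha⟩, _, hb⟩ ⟨⟨_, hZ⟩, _, hZ'⟩ f g h hT (hk Z hZ hZ')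

lemma prop_singleFunctor_obj (p : ObjectProperty (DerivedCategory C)) [p.IsTriangulated]
    [p.IsClosedUnderIsomorphisms] {M : C} (hM : p ((singleFunctor C 0).obj M)) (n : ℤ) :
    p ((singleFunctor C n).obj M) :=
  p.prop_of_iso (((singleFunctors C).shiftIso (-n) n 0 (by lia)).app M) (p.le_shift (-n) _ hM)

lemma prop_of_bounded [EnoughProjectives C] (p : ObjectProperty (DerivedCategory C))
    [p.IsTriangulated] [p.IsClosedUnderIsomorphisms]
    (hp : ∀ M : C, p ((singleFunctor C 0).obj M)) (X : DerivedCategory C) (hX : t.bounded X) :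
    p X :=
  bounded_induction p (fun n M ↦ prop_singleFunctor_obj p (hp M) n)
    (fun n P _ _ _ _ _ _ _ _ hT hZ ↦
      p.ext_of_isTriangulatedClosed₂ _ hT (prop_singleFunctor_obj p (hp P) n) hZ) X hX

end DerivedCategory

/-! ### From bounded complexes to single objects -/

section

variable [HasDerivedCategory.{w'} C]

lemma EventuallyOrthogonal.of_singleFunctor_obj [EnoughProjectives C] {X : DerivedCategory C}
    (h : ∀ N : C, EventuallyOrthogonal X ((singleFunctor C 0).obj N)) (Y : DerivedCategory C)
    (hY : t.bounded Y) : EventuallyOrthogonal X Y :=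
  prop_of_bounded (rightEventuallyOrthogonal X) h Y hY

lemma eventuallyOrthogonal_singleFunctor_of_hasProjectiveDimensionLT (M N : C) (n : ℕ)
    [HasProjectiveDimensionLT M n] :
    EventuallyOrthogonal ((singleFunctor C 0).obj M) ((singleFunctor C 0).obj N) := by
  let := HasExt.standard C
  exact (eventuallyOrthogonal_singleFunctor_iff M N).2
    ⟨n, fun i hi ↦ HasProjectiveDimensionLT.subsingleton M n i hi.le N⟩

lemma EventuallyOrthogonal.of_projective [EnoughProjectives C] (P : C) [Projective P] (n : ℤ)
    (Y : DerivedCategory C) (hY : t.bounded Y) :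
    EventuallyOrthogonal ((singleFunctor C n).obj P) Y :=
  prop_singleFunctor_obj (leftEventuallyOrthogonal Y) (of_singleFunctor_obj
    (fun N ↦ eventuallyOrthogonal_singleFunctor_of_hasProjectiveDimensionLT P N 1) Y hY) n

/-- Syzygies reduce the dimension: `M` is the cone of a map from its syzygy to a projective. -/
lemma EventuallyOrthogonal.of_hasProjectiveDimensionLT [EnoughProjectives C]
    {X : DerivedCategory C}
    (h : ∀ (P : C) [Projective P], EventuallyOrthogonal X ((singleFunctor C 0).obj P))
    (n : ℕ) (M : C) [hM : HasProjectiveDimensionLT M (n + 1)] :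
    EventuallyOrthogonal X ((singleFunctor C 0).obj M) := by
  induction n generalizing M with
  | zero =>
    have := projective_iff_hasProjectiveDimensionLT_one.2 hM
    exact h M
  | succ n hn =>
    let S := ShortComplex.mk _ _ (kernel.condition (Projective.π M))
    have hS : S.ShortExact := { exact := ShortComplex.exact_kernel (Projective.π M) }
    have : HasProjectiveDimensionLT (kernel (Projective.π M)) (n + 1) :=
      hS.hasProjectiveDimensionLT_X₁ (n + 1)
        (inferInstanceAs (HasProjectiveDimensionLT (Projective.over M) (n + 1))) hM
    exact (rightEventuallyOrthogonal X).ext_of_isTriangulatedClosed₃ _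
      hS.singleTriangle_distinguished (hn _) (h (Projective.over M))

variable (C) in
/-- The generalized Auslander-Reiten condition for the objects of an abelian category. -/
def AbelianAuslanderReitenCondition : Prop :=
  ∀ M : C, EventuallyOrthogonal ((singleFunctor C 0).obj M) ((singleFunctor C 0).obj M) →
    (∀ (P : C) [Projective P],
      EventuallyOrthogonal ((singleFunctor C 0).obj M) ((singleFunctor C 0).obj P)) →
    ∀ N : C, EventuallyOrthogonal ((singleFunctor C 0).obj M) ((singleFunctor C 0).obj N)

lemma bounded_singleFunctor_obj (n : ℤ) (M : C) : t.bounded ((singleFunctor C n).obj M) :=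
  ⟨⟨n, inferInstance⟩, n, inferInstance⟩

lemma eventuallyOrthogonal_bounded_iff (X Y : Bounded C) :
    EventuallyOrthogonal X.obj Y.obj ↔ EventuallyOrthogonal X Y :=
  eventuallyOrthogonal_map_iff Bounded.ι X Y

lemma homologicallyPerfect_bounded_iff [EnoughProjectives C] (X : Bounded C) :
    HomologicallyPerfect X ↔ ∀ N : C, EventuallyOrthogonal X.obj ((singleFunctor C 0).obj N) :=
  ⟨fun h N ↦ (eventuallyOrthogonal_bounded_iff X ⟨_, bounded_singleFunctor_obj 0 N⟩).2 (h _),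
    fun h Y ↦ (eventuallyOrthogonal_bounded_iff X Y).1
      (EventuallyOrthogonal.of_singleFunctor_obj h Y.obj Y.property)⟩

lemma AbelianAuslanderReitenCondition.eventuallyOrthogonal [EnoughProjectives C]
    (hC : AbelianAuslanderReitenCondition C) (X : DerivedCategory C) (hX : t.bounded X)
    (h₁ : EventuallyOrthogonal X X)
    (h₂ : ∀ (P : C) [Projective P], EventuallyOrthogonal X ((singleFunctor C 0).obj P)) (N : C) :
    EventuallyOrthogonal X ((singleFunctor C 0).obj N) := by
  let p : ObjectProperty (DerivedCategory C) := fun X ↦ EventuallyOrthogonal X X →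
    (∀ (P : C) [Projective P], EventuallyOrthogonal X ((singleFunctor C 0).obj P)) →
    ∀ N : C, EventuallyOrthogonal X ((singleFunctor C 0).obj N)
  have : p.IsClosedUnderIsomorphisms := ⟨fun e h h₁ h₂ N ↦
    (h ((h₁.of_iso_left e.symm).of_iso_right e.symm) (fun P _ ↦ (h₂ P).of_iso_left e.symm)
      N).of_iso_left e⟩
  refine bounded_induction p (fun n M h₁ h₂ ↦ ?_) ?_ X hX h₁ h₂ N
  · let e : ((singleFunctor C n).obj M)⟦n⟧ ≅ (singleFunctor C 0).obj M :=
      ((singleFunctors C).shiftIso n 0 n (by lia)).app M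
    intro N
    refine prop_singleFunctor_obj (leftEventuallyOrthogonal _) (hC M ?_ (fun P _ ↦ ?_) N) n
    · exact (((h₁.shift_right n).shift_left n).of_iso_left e).of_iso_right e
    · exact ((h₂ P).shift_left n).of_iso_left e
  · intro n P X Z _ hX hZ f g h hT hpZ h₁ h₂ N
    have hP (Y) (hY : t.bounded Y) : EventuallyOrthogonal ((singleFunctor C n).obj P) Y :=
      .of_projective P n Y hY
    -- Since `P` is perfect, the hypotheses on `X` pass to `Z`. Self-orthogonality needs two moves:
    -- `X ⊥ P` and `X ⊥ X` give `X ⊥ Z`, whence `Z ⊥ Z`.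
    have hl {Y} (hY : t.bounded Y) (h : EventuallyOrthogonal X Y) : EventuallyOrthogonal Z Y :=
      (leftEventuallyOrthogonal Y).ext_of_isTriangulatedClosed₃ _ hT (hP Y hY) h
    have hXZ : EventuallyOrthogonal X Z :=
      (rightEventuallyOrthogonal X).ext_of_isTriangulatedClosed₃ _ hT
        (prop_singleFunctor_obj (rightEventuallyOrthogonal X) (h₂ P) n) h₁
    exact (leftEventuallyOrthogonal _).ext_of_isTriangulatedClosed₂ _ hT
      (hP _ (bounded_singleFunctor_obj 0 N))
      (hpZ (hl hZ hXZ) (fun Q _ ↦ hl (bounded_singleFunctor_obj 0 Q) (h₂ Q)) N)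

/-- Perfect objects are built from projectives: peeling projectives off `Y` keeps it perfect and
ends at a shifted object, of finite projective dimension by `hC`. -/
lemma eventuallyOrthogonal_of_homologicallyPerfect [EnoughProjectives C]
    (hC : ∀ M : C,
      (∀ N : C, EventuallyOrthogonal ((singleFunctor C 0).obj M) ((singleFunctor C 0).obj N)) →
        ∃ n, HasProjectiveDimensionLT M n)
    {X : DerivedCategory C}
    (hX : ∀ (P : C) [Projective P], EventuallyOrthogonal X ((singleFunctor C 0).obj P))
    (Y : DerivedCategory C) (hY : t.bounded Y)
    (h : ∀ N : C, EventuallyOrthogonal Y ((singleFunctor C 0).obj N)) :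
    EventuallyOrthogonal X Y := by
  let p : ObjectProperty (DerivedCategory C) := fun Y ↦
    (∀ N : C, EventuallyOrthogonal Y ((singleFunctor C 0).obj N)) → EventuallyOrthogonal X Y
  have : p.IsClosedUnderIsomorphisms := ⟨fun e h h' ↦
    (h fun N ↦ (h' N).of_iso_left e.symm).of_iso_right e⟩
  refine bounded_induction p (fun n M h ↦ ?_) ?_ Y hY h
  · let e : ((singleFunctor C n).obj M)⟦n⟧ ≅ (singleFunctor C 0).obj M :=
      ((singleFunctors C).shiftIso n 0 n (by lia)).app M
    obtain ⟨m, _⟩ := hC M fun N ↦ ((h N).shift_left n).of_iso_left e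
    exact prop_singleFunctor_obj (rightEventuallyOrthogonal X)
      (.of_hasProjectiveDimensionLT hX m M (hM := hasProjectiveDimensionLT_of_ge M m _ (by lia))) n
  · intro n P Y Z _ hY hZ f g k hT hpZ h
    refine (rightEventuallyOrthogonal X).ext_of_isTriangulatedClosed₂ _ hT
      (prop_singleFunctor_obj (rightEventuallyOrthogonal X) (hX P) n) (hpZ fun N ↦ ?_)
    exact (leftEventuallyOrthogonal _).ext_of_isTriangulatedClosed₃ _ hT
      (.of_projective P n _ (bounded_singleFunctor_obj 0 N)) (h N)

lemma auslanderReitenCondition_bounded_iff [EnoughProjectives C]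
    (hC : ∀ M : C,
      (∀ N : C, EventuallyOrthogonal ((singleFunctor C 0).obj M) ((singleFunctor C 0).obj N)) →
        ∃ n, HasProjectiveDimensionLT M n) :
    AuslanderReitenCondition (Bounded C) ↔ AbelianAuslanderReitenCondition C := by
  constructor
  · intro h M h₁ h₂
    let X : Bounded C := ⟨_, bounded_singleFunctor_obj 0 M⟩
    refine (homologicallyPerfect_bounded_iff X).1 (h X ?_ fun P hP ↦ ?_)
    · exact (eventuallyOrthogonal_bounded_iff X X).1 h₁
    · exact (eventuallyOrthogonal_bounded_iff X P).1
        (eventuallyOrthogonal_of_homologicallyPerfect hC h₂ P.obj P.property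
          ((homologicallyPerfect_bounded_iff P).1 hP))
  · intro h X h₁ h₂
    refine (homologicallyPerfect_bounded_iff X).2 (h.eventuallyOrthogonal X.obj X.property
      ((eventuallyOrthogonal_bounded_iff X X).2 h₁) fun P _ ↦ ?_)
    let P' : Bounded C := ⟨_, bounded_singleFunctor_obj 0 P⟩
    exact (eventuallyOrthogonal_bounded_iff X P').2 (h₂ P' fun Y ↦
      (eventuallyOrthogonal_bounded_iff P' Y).1 (.of_projective P 0 Y.obj Y.property))

end

/-! ### Bounds on projective dimension and vanishing of `Ext` -/

/-- If all `Ext X P i` vanish for `P` projective and `i > r`, and if `X` has finite projective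
dimension, then this dimension is at most `r`. -/
lemma hasProjectiveDimensionLE_of_subsingleton_ext_projective [EnoughProjectives C]
    [HasExt.{w} C] (X : C) (r n : ℕ) [hX : HasProjectiveDimensionLT X n]
    (h : ∀ (P : C) [Projective P] (i : ℕ), r < i → Subsingleton (Ext X P i)) :
    HasProjectiveDimensionLE X r := by
  -- Descending induction on `i` from `n`: a class in `Ext X Y i` has zero image in `Ext^{i+1}` of
  -- the syzygy of `Y`, so it lifts to a projective, where `Ext` vanishes.
  suffices ∀ (d i : ℕ), r < i → n ≤ i + d → ∀ (Y : C) (e : Ext X Y i), e = 0 from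
    HasProjectiveDimensionLT.mk fun i hi Y e ↦ this n i hi (by lia) Y e
  intro d
  induction d with
  | zero => exact fun i _ hi Y e ↦ e.eq_zero_of_hasProjectiveDimensionLT n hi
  | succ d hd =>
    intro i hi hn Y e
    have hS : (ShortComplex.mk _ _ (kernel.condition (Projective.π Y))).ShortExact :=
      { exact := ShortComplex.exact_kernel (Projective.π Y) }
    obtain ⟨x, rfl⟩ := Ext.covariant_sequence_exact₃ X hS e rfl
      (hd (i + 1) (by lia) (by lia) _ _)
    have := h (Projective.over Y) i hi
    rw [Subsingleton.elim x 0, Ext.zero_comp]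

lemma Functor.hasProjectiveDimensionLT_obj {D : Type*} [Category* D] [Abelian D]
    [EnoughProjectives C] (F : C ⥤ D) [F.Additive] [PreservesFiniteLimits F]
    [PreservesFiniteColimits F] [F.PreservesProjectiveObjects] (X : C) (n : ℕ)
    [hX : HasProjectiveDimensionLT X (n + 1)] : HasProjectiveDimensionLT (F.obj X) (n + 1) := by
  induction n generalizing X with
  | zero =>
    have := projective_iff_hasProjectiveDimensionLT_one.2 hX
    exact projective_iff_hasProjectiveDimensionLT_one.1 (F.projective_obj X)
  | succ n hn =>
    have hS : (ShortComplex.mk _ _ (kernel.condition (Projective.π X))).ShortExact :=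
      { exact := ShortComplex.exact_kernel (Projective.π X) }
    have := (hS.hasProjectiveDimensionLT_X₃_iff n
      (inferInstanceAs (Projective (Projective.over X)))).1 hX
    exact ((hS.map F).hasProjectiveDimensionLT_X₃_iff n
      (F.projective_obj (Projective.over X))).2 (hn _)

end CategoryTheory

namespace CategoryTheory.Abelian.Ext

variable {C : Type u} [Category.{v} C] [Abelian C] [HasExt.{w} C]

lemma subsingleton_of_retract {X Y Z : C} (h : Retract Y Z) (i : ℕ)
    [Subsingleton (Ext X Z i)] : Subsingleton (Ext X Y i) :=
  subsingleton_of_forall_eq 0 fun e ↦ by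
    rw [← e.comp_mk₀_id, ← h.retract, ← mk₀_comp_mk₀,
      ← comp_assoc_of_second_deg_zero, Subsingleton.elim (e.comp (mk₀ h.i) (add_zero i)) 0,
      zero_comp]

lemma subsingleton_of_shortExact (X : C) {S : ShortComplex C} (hS : S.ShortExact) (i : ℕ)
    [Subsingleton (Ext X S.X₁ i)] [Subsingleton (Ext X S.X₃ i)] :
    Subsingleton (Ext X S.X₂ i) :=
  subsingleton_of_forall_eq 0 fun e ↦ by
    obtain ⟨x, rfl⟩ := covariant_sequence_exact₂ X hS e (Subsingleton.elim _ _)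
    rw [Subsingleton.elim x 0, zero_comp]

end CategoryTheory.Abelian.Ext

/-! ### Finitely generated modules over Noetherian and Artinian rings -/

namespace FGModuleCat

variable {A : Type u} [Ring A]

lemma projective_of (P : Type u) [AddCommGroup P] [Module A P] [Module.Finite A P]
    [IsNoetherianRing A] [Module.Projective A P] : Projective (of A P) where
  factors {E X} f e he := by
    have : Epi ((forget₂ (FGModuleCat A) (ModuleCat A)).map e) := inferInstance
    obtain ⟨g, hg⟩ := Module.projective_lifting_property e.hom.hom f.hom.hom
      ((ModuleCat.epi_iff_surjective _).1 this)
    exact ⟨ObjectProperty.homMk (ModuleCat.ofHom g), by ext : 1; exact hg⟩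

lemma epi_of_surjective {X Y : FGModuleCat.{u} A} (f : X ⟶ Y)
    (hf : Function.Surjective f.hom.hom) : Epi f :=
  (forget₂ (FGModuleCat A) (ModuleCat A)).epi_of_epi_map ((ModuleCat.epi_iff_surjective _).2 hf)

lemma exists_epi_free (M : FGModuleCat.{u} A) : ∃ (n : ℕ) (f : of A (Fin n → A) ⟶ M), Epi f := by
  obtain ⟨n, f, hf⟩ := Module.Finite.exists_fin' A M
  exact ⟨n, ObjectProperty.homMk (ModuleCat.ofHom f), epi_of_surjective _ hf⟩

lemma exists_retract_free (P : FGModuleCat.{u} A) [Projective P] :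
    ∃ n : ℕ, Nonempty (Retract P (of A (Fin n → A))) := by
  obtain ⟨n, f, hf⟩ := exists_epi_free P
  exact ⟨n, ⟨⟨Projective.factorThru (𝟙 P) f, f, Projective.factorThru_comp _ _⟩⟩⟩

variable [IsNoetherianRing A]

instance : EnoughProjectives (FGModuleCat.{u} A) where
  presentation M := by
    obtain ⟨n, f, hf⟩ := exists_epi_free M
    exact ⟨{ p := _, projective := projective_of (Fin n → A), f := f, epi := hf }⟩

instance : (forget₂ (FGModuleCat.{u} A) (ModuleCat A)).Additive where

instance : (forget₂ (FGModuleCat.{u} A) (ModuleCat A)).PreservesProjectiveObjects where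
  projective_obj {P} hP := by
    obtain ⟨n, ⟨h⟩⟩ := exists_retract_free P
    have : Projective ((forget₂ (FGModuleCat.{u} A) (ModuleCat A)).obj (of A (Fin n → A))) :=
      (IsProjective.iff_projective _).1 inferInstance
    exact (h.map (forget₂ (FGModuleCat.{u} A) (ModuleCat A))).projective

/-- The short complex `N ⟶ M ⟶ M ⧸ N` attached to a submodule `N` of `M`. -/
noncomputable abbrev submoduleShortComplex {M : Type u} [AddCommGroup M] [Module A M]
    [Module.Finite A M] (N : Submodule A M) [Module.Finite A N] :
    ShortComplex (FGModuleCat.{u} A) :=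
  .mk (X₁ := of A N) (X₂ := of A M) (X₃ := of A (M ⧸ N)) (ofHom N.subtype) (ofHom N.mkQ)
    (by ext x; exact (Submodule.Quotient.mk_eq_zero N).2 x.2)

lemma submoduleShortComplex_shortExact {M : Type u} [AddCommGroup M] [Module A M]
    [Module.Finite A M] (N : Submodule A M) [Module.Finite A N] :
    (submoduleShortComplex N).ShortExact := by
  let F := forget₂ (FGModuleCat.{u} A) (ModuleCat A)
  have : Mono (F.map (submoduleShortComplex N).f) :=
    (ModuleCat.mono_iff_injective _).2 N.injective_subtype
  have : Epi (F.map (submoduleShortComplex N).g) :=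
    (ModuleCat.epi_iff_surjective _).2 N.mkQ_surjective
  exact
    { exact := ((submoduleShortComplex N).exact_map_iff_of_faithful F).1
        ((ShortComplex.ShortExact.moduleCat_exact_iff_function_exact _).2
          (LinearMap.exact_subtype_mkQ N))
      mono_f := F.mono_of_mono_map ‹_›
      epi_g := F.epi_of_epi_map ‹_› }

section

variable [HasExt.{w} (FGModuleCat.{u} A)]

/-- The inclusion into all modules is exact, fully faithful and preserves projectives, so it induces
bijections on `Ext`. -/
lemma subsingleton_ext_iff [HasExt.{w'} (ModuleCat.{u} A)] (X Y : FGModuleCat.{u} A) (i : ℕ) :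
    Subsingleton (Ext X Y i) ↔ Subsingleton (Ext X.obj Y.obj i) :=
  (Equiv.ofBijective _ ((forget₂ (FGModuleCat.{u} A)
    (ModuleCat A)).mapExt_bijective_of_preservesProjectiveObjects X Y i)).subsingleton_congr

lemma subsingleton_ext_of_projective (X : FGModuleCat.{u} A) (i : ℕ)
    [Subsingleton (Ext X (of A A) i)] (P : FGModuleCat.{u} A) [Projective P] :
    Subsingleton (Ext X P i) := by
  obtain ⟨n, ⟨h⟩⟩ := exists_retract_free P
  suffices Subsingleton (Ext X (of A (Fin n → A)) i) from Ext.subsingleton_of_retract h i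
  refine subsingleton_of_forall_eq 0 fun e ↦ ?_
  have hid : ∑ j : Fin n, (ofHom (LinearMap.proj j) : of A (Fin n → A) ⟶ of A A) ≫
      ofHom (LinearMap.single A (fun _ ↦ A) j) = 𝟙 _ := by
    apply (forget₂ (FGModuleCat A) (ModuleCat A)).map_injective
    rw [Functor.map_sum]
    apply ModuleCat.hom_ext
    rw [ModuleCat.hom_sum]
    refine LinearMap.ext fun x ↦ ?_
    rw [LinearMap.sum_apply]
    exact LinearMap.sum_single_apply _ x
  -- Postcomposition is written as an additive map, so that it distributes over the decomposition of
  -- the identity into maps factoring through `A`.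
  have hmk (f : of A (Fin n → A) ⟶ of A (Fin n → A)) :
      e.comp (Ext.mk₀ f) (add_zero i) = Ext.bilinearComp _ _ _ i 0 i rfl e (Ext.addEquiv₀.symm f) :=
    rfl
  rw [← e.comp_mk₀_id, ← hid, hmk, map_sum, map_sum]
  refine Finset.sum_eq_zero fun j _ ↦ ?_
  rw [← hmk, ← Ext.mk₀_comp_mk₀, ← Ext.comp_assoc_of_second_deg_zero,
    Subsingleton.elim (e.comp _ (add_zero i)) 0, Ext.zero_comp]

lemma subsingleton_ext_of_isSimpleModule [IsArtinianRing A] (X : FGModuleCat.{u} A) (i : ℕ)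
    [Subsingleton (Ext X (of A (A ⧸ Ring.jacobson A)) i)] (N : Type u) [AddCommGroup N]
    [Module A N] [Module.Finite A N] [IsSimpleModule A N] : Subsingleton (Ext X (of A N) i) := by
  obtain ⟨m, hm, ⟨e⟩⟩ := isSimpleModule_iff_quot_maximal.1 ‹IsSimpleModule A N›
  -- Every simple module is a quotient of `A ⧸ rad A`, and by semisimplicity a direct summand of it.
  have hJ : IsSemisimpleModule A (A ⧸ Ring.jacobson A) :=
    (IsArtinian.isSemisimpleModule_iff_jacobson A _).2 (Module.jacobson_quotient_jacobson A A)
  let f : (A ⧸ Ring.jacobson A) →ₗ[A] N :=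
    e.symm.toLinearMap ∘ₗ Submodule.factor (sInf_le hm.out)
  have hf : Function.Surjective f :=
    e.symm.surjective.comp (Submodule.factor_surjective _)
  obtain ⟨g, hg⟩ := IsSemisimpleModule.lifting_property f hf LinearMap.id
  exact Ext.subsingleton_of_retract (Z := of A (A ⧸ Ring.jacobson A))
    ⟨ofHom g, ofHom f, by ext : 1; exact hg⟩ i

lemma subsingleton_ext_of_jacobson [IsArtinianRing A] (X : FGModuleCat.{u} A) (i : ℕ)
    [Subsingleton (Ext X (of A (A ⧸ Ring.jacobson A)) i)] (N : FGModuleCat.{u} A) :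
    Subsingleton (Ext X N i) := by
  suffices ∀ (N : Type u) [AddCommGroup N] [Module A N],
      IsFiniteLength A N → ∀ [Module.Finite A N], Subsingleton (Ext X (of A N) i) from
    this N (isFiniteLength_iff_isNoetherian_isArtinian.2
      ⟨isNoetherian_of_isNoetherianRing_of_finite A N, isArtinian_of_fg_of_artinian'⟩)
  intro N _ _ hN
  induction hN with
  | @of_subsingleton M =>
    intro _
    have : IsZero (of A M) := by
      rw [IsZero.iff_id_eq_zero]
      ext x
      exact Subsingleton.elim (α := M) _ _
    exact subsingleton_of_forall_eq 0 fun e ↦ by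
      rw [← e.comp_mk₀_id, this.eq_of_src (𝟙 _) 0, Ext.mk₀_zero, Ext.comp_zero]
  | @of_simple_quotient M _ _ N _ _ hN =>
    intro _
    have := isNoetherian_of_isNoetherianRing_of_finite A M
    have : Subsingleton (Ext X (submoduleShortComplex N).X₁ i) := hN
    have : Subsingleton (Ext X (submoduleShortComplex N).X₃ i) :=
      subsingleton_ext_of_isSimpleModule X i (M ⧸ N)
    exact Ext.subsingleton_of_shortExact X (submoduleShortComplex_shortExact N) i

end

/-- The bound in `h` may depend on `N`. The one for `N = A ⧸ rad A` works for all `N`, by induction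
on length. -/
lemma exists_hasProjectiveDimensionLT [IsArtinianRing A]
    [HasDerivedCategory.{w'} (FGModuleCat.{u} A)] (M : FGModuleCat.{u} A)
    (h : ∀ N : FGModuleCat.{u} A,
      EventuallyOrthogonal ((singleFunctor _ 0).obj M) ((singleFunctor _ 0).obj N)) :
    ∃ n, HasProjectiveDimensionLT M n := by
  let := HasExt.standard (FGModuleCat.{u} A)
  obtain ⟨n, hn⟩ := (eventuallyOrthogonal_singleFunctor_iff M _).1
    (h (of A (A ⧸ Ring.jacobson A)))
  refine ⟨n + 1, .mk fun i hi N e ↦ ?_⟩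
  have := hn i hi
  have := subsingleton_ext_of_jacobson M i N
  exact Subsingleton.elim _ _

lemma abelianAuslanderReitenCondition_iff [IsArtinianRing A]
    [HasDerivedCategory.{w'} (FGModuleCat.{u} A)] :
    AbelianAuslanderReitenCondition (FGModuleCat.{u} A) ↔ GeneralizedAuslanderReiten A := by
  let := HasExt.standard (FGModuleCat.{u} A)
  constructor
  · intro h M _ _ _ r hM
    let X : FGModuleCat.{u} A := of A M
    have h₁ (i : ℕ) (hi : r < i) : Subsingleton (Ext X X i) :=
      (subsingleton_ext_iff X X i).2 (hM i hi).1
    have h₂ (P : FGModuleCat.{u} A) [Projective P] (i : ℕ) (hi : r < i) :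
        Subsingleton (Ext X P i) :=
      have : Subsingleton (Ext X (of A A) i) := (subsingleton_ext_iff _ _ i).2 (hM i hi).2
      subsingleton_ext_of_projective X i P
    obtain ⟨n, _⟩ := exists_hasProjectiveDimensionLT X
      (h X ((eventuallyOrthogonal_singleFunctor_iff X X).2 ⟨r, h₁⟩)
        fun P _ ↦ (eventuallyOrthogonal_singleFunctor_iff X P).2 ⟨r, h₂ P⟩)
    have := hasProjectiveDimensionLE_of_subsingleton_ext_projective X r n h₂
    exact (projectiveDimension_le_iff _ r).2
      ((forget₂ (FGModuleCat.{u} A) (ModuleCat A)).hasProjectiveDimensionLT_obj X r)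
  · intro h M h₁ h₂ N
    obtain ⟨m, hm⟩ := (eventuallyOrthogonal_singleFunctor_iff M M).1 h₁
    have := projective_of (A := A) A
    obtain ⟨n, hn⟩ := (eventuallyOrthogonal_singleFunctor_iff M _).1 (h₂ (of A A))
    -- The conjecture takes one `r` for both vanishing conditions, hence the maximum.
    have hpd := (projectiveDimension_le_iff _ (max m n)).1 <| h M (max m n) fun i hi ↦
      ⟨(subsingleton_ext_iff M M i).1 (hm i (by lia)),
        (subsingleton_ext_iff M (of A A) i).1 (hn i (by lia))⟩
    exact (eventuallyOrthogonal_singleFunctor_iff M N).2 ⟨max m n, fun i hi ↦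
      (subsingleton_ext_iff M N i).2 (hpd.subsingleton _ _ i hi _)⟩

end FGModuleCat

instance IsArtinAlgebra.isArtinianRing (A : Type u) [Ring A] [h : IsArtinAlgebra A] :
    IsArtinianRing A := by
  obtain ⟨R, _, _, _, _⟩ := h.exists_base
  have : IsArtinian R A := isArtinian_of_fg_of_artinian'
  exact isArtinian_of_tower R inferInstance

theorem theorem1p1 (A : Type u) (B : Type v) [Ring A] [Ring B]
    [IsArtinAlgebra A] [IsArtinAlgebra B] (h : DerivedEquivalent A B) :
    GeneralizedAuslanderReiten A ↔ GeneralizedAuslanderReiten B := by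
  let := HasDerivedCategory.standard (FGModuleCat.{u} A)
  let := HasDerivedCategory.standard (FGModuleCat.{v} B)
  obtain ⟨F, _, _, _⟩ := h
  rw [← FGModuleCat.abelianAuslanderReitenCondition_iff (A := A),
    ← FGModuleCat.abelianAuslanderReitenCondition_iff (A := B),
    ← auslanderReitenCondition_bounded_iff FGModuleCat.exists_hasProjectiveDimensionLT,
    ← auslanderReitenCondition_bounded_iff FGModuleCat.exists_hasProjectiveDimensionLT]
  exact auslanderReitenCondition_iff_of_isEquivalence F
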